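/- **Theorem (Flash Attention).** The one-shot partial-computing red-blue pebble game (PRBP) with fast memory of size $r$ on a finite DAG $G=(V,E)$ is played as follows. Each node carries either no pebble, a blue pebble only, a blue and a light red pebble, or a dark red pebble only. Initially exactly the source nodes carry a blue pebble, there are no other pebbles, and no edge is marked. The moves are: (save) replace a dark red pebble by a blue and a light red pebble; (load) place a light red pebble on a node that has a blue pebble; (partial compute) for an unmarked edge $(u,v)$ such that all incoming edges of $u$ are marked, $u$ has a red (light or dark) pebble, and $v$ has either a red pebble or no pebble at all, replace all pebbles on $v$ by a dark red pebble and mark $(u,v)$; (delete) remove a light red pebble from a node, or a dark red pebble from a node all of whose outgoing edges are marked. At most $r$ nodes may carry a red pebble at any time. In the end every sink must carry a blue pebble and every edge must be marked. The cost of a strategy is its number of save and load moves, and $\mathrm{OPT}_{PRBP}(G,r)$ is the minimum cost of a strategy ($+\infty$ if there is none). For $m,d\ge 1$, the self-attention DAG of $m\times d$ matrices $Q,K,V$ with standard matrix multiplication, computing $\mathrm{softmax}(QK^T)V$, consists of * source nodes $Q_{i,l}$, $K_{j,l}$ and $V_{j,l}$ ($i,j\in[m]$, $l\in[d]$); * for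 all $i,j,l$ a product node $p_{i,j,l}$ with incoming edges from $Q_{i,l}$ and $K_{j,l}$, and for all $i,j$ a score node $s_{i,j}$ (the entry $(i,j)$ of $QK^T$) with incoming edges from $p_{i,j,1},\dots,p_{i,j,d}$; * for all $i,j$ a node $e_{i,j}$ (the exponential) with an incoming edge from $s_{i,j}$, for all $i$ a row-sum node $\sigma_i$ with incoming edges from $e_{i,1},\dots,e_{i,m}$, and for all $i,j$ a weight node $w_{i,j}$ with incoming edges from $e_{i,j}$ and $\sigma_i$; * for all $i,j,l$ a product node $p'_{i,j,l}$ with incoming edges from $w_{i,j}$ and $V_{j,l}$, and for all $i,l$ an output node $o_{i,l}$ with incoming edges from $p'_{i,1,l},\dots,p'_{i,m,l}$. There is an absolute constant $c>0$ such that for all integers $m,d,r\ge 1$, the self-attention DAG $G$ satisfies $$\mathrm{OPT}_{PRBP}(G,r)\;\ge\; c\cdot\min\left(\frac{m^2 d}{\sqrt r},\ \frac{m^2d^2}{r}\right).$$ The same bound, with the same constant $c$, holds for every DAG obtained from the nodes $Q_{i,l}$, $K_{j,l}$, $p_{i,j,l}$, $s_{i,j}$ and the edges between them by continuing with an arbitrary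 finite DAG $T$ on further nodes, with arbitrary edges from score nodes to nodes of $T$ such that every score node has at least one outgoing edge. -/

import Mathlib

/-- A directed acyclic graph on the node set `V`; `Adj u v` means that there is an edge `(u, v)`. -/
structure Dag (V : Type*) where
  Adj : V → V → Prop
  acyclic : ∀ v, ¬ Relation.TransGen Adj v v

namespace Dag

def IsSource {V : Type*} (G : Dag V) (v : V) : Prop := ∀ u, ¬ G.Adj u v

def IsSink {V : Type*} (G : Dag V) (v : V) : Prop := ∀ w, ¬ G.Adj v w

/-- A relation along which a natural number strictly increases is acyclic. -/
theorem acyclic_of_rank {V : Type*} {R : V → V → Prop} (f : V → ℕ)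
    (h : ∀ u v, R u v → f u < f v) (v : V) : ¬ Relation.TransGen R v v := by
  have key : ∀ u w, Relation.TransGen R u w → f u < f w := by
    intro u w huw
    induction huw with
    | single h1 => exact h _ _ h1
    | tail _ h2 ih => exact ih.trans (h _ _ h2)
  exact fun hv => lt_irrefl _ (key v v hv)

end Dag

/-! ### The partial-computing red-blue pebble game (one-shot) -/

namespace PRBP

/-- The four possible sets of pebbles on a node: no pebble; only a blue pebble; a blue and a
light red pebble; only a dark red pebble. -/
inductive Pebbles where
  | empty
  | blue
  | blueLight
  | dark

/-- The node carries a (light or dark) red pebble. -/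
def Pebbles.HasRed (p : Pebbles) : Prop := p = .blueLight ∨ p = .dark

/-- The node carries a blue pebble. -/
def Pebbles.HasBlue (p : Pebbles) : Prop := p = .blue ∨ p = .blueLight

/-- A configuration of the game: the pebbles on every node, and the set of marked edges. -/
structure Config (V : Type*) where
  pebbles : V → Pebbles
  marked : Set (V × V)

/-- The moves of the game; `compute u v` is the partial compute step on the edge `(u, v)`. -/
inductive Move (V : Type*) where
  | save (v : V)
  | load (v : V)
  | compute (u v : V)
  | delete (v : V)

/-- Saves and loads cost `1`, partial compute steps and deletions are free. -/
def Move.cost {V : Type*} : Move V → ℕ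
  | .save _ => 1
  | .load _ => 1
  | .compute _ _ => 0
  | .delete _ => 0

/-- The condition under which a move may be executed. A light red pebble may always be deleted,
a dark red pebble only if all outgoing edges of the node are marked. -/
def Legal {V : Type*} (G : Dag V) (s : Config V) : Move V → Prop
  | .save v => s.pebbles v = .dark
  | .load v => (s.pebbles v).HasBlue
  | .compute u v =>
      G.Adj u v ∧ (u, v) ∉ s.marked ∧ (∀ w, G.Adj w u → (w, u) ∈ s.marked) ∧
        (s.pebbles u).HasRed ∧ ((s.pebbles v).HasRed ∨ s.pebbles v = .empty)
  | .delete v =>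
      s.pebbles v = .blueLight ∨
        (s.pebbles v = .dark ∧ ∀ w, G.Adj v w → (v, w) ∈ s.marked)

open Classical in
/-- The configuration after a (legal) move. -/
noncomputable def step {V : Type*} (s : Config V) : Move V → Config V
  | .save v => { s with pebbles := Function.update s.pebbles v .blueLight }
  | .load v => { s with pebbles := Function.update s.pebbles v .blueLight }
  | .compute u v =>
      { pebbles := Function.update s.pebbles v .dark, marked := insert (u, v) s.marked }
  | .delete v =>
      { s with pebbles := Function.update s.pebbles v
                (if s.pebbles v = .blueLight then .blue else .empty) }

open Classical in
/-- Initially exactly the sources carry a blue pebble, and no edge is marked. -/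
noncomputable def initial {V : Type*} (G : Dag V) : Config V where
  pebbles := fun v => if G.IsSource v then .blue else .empty
  marked := ∅

/-- In the end every sink carries a blue pebble, and every edge is marked. -/
def Terminal {V : Type*} (G : Dag V) (s : Config V) : Prop :=
  (∀ v, G.IsSink v → (s.pebbles v).HasBlue) ∧ ∀ u v, G.Adj u v → (u, v) ∈ s.marked

/-- The number of red pebbles is at most `r`. -/
def FitsIn {V : Type*} (s : Config V) (r : ℕ) : Prop :=
  {v | (s.pebbles v).HasRed}.encard ≤ (r : ℕ∞)

/-- The list of moves is legal from the configuration `s` on, never uses more than `r` red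
pebbles, and ends in a terminal configuration. -/
def Completes {V : Type*} (G : Dag V) (r : ℕ) : Config V → List (Move V) → Prop
  | s, [] => FitsIn s r ∧ Terminal G s
  | s, a :: l => FitsIn s r ∧ Legal G s a ∧ Completes G r (step s a) l

/-- A pebbling strategy with fast memory of size `r`. -/
def IsStrategy {V : Type*} (G : Dag V) (r : ℕ) (l : List (Move V)) : Prop :=
  Completes G r (initial G) l

/-- The cost of a strategy: its total number of save and load operations. -/
def cost {V : Type*} (l : List (Move V)) : ℕ := (l.map Move.cost).sum

/-- The optimal cost of a strategy (`⊤` if there is no strategy at all). -/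
noncomputable def opt {V : Type*} (G : Dag V) (r : ℕ) : ℕ∞ :=
  ⨅ (l : List (Move V)) (_ : IsStrategy G r l), (cost l : ℕ∞)

end PRBP

/-! ### Attention DAGs -/

namespace Attention

/-- The nodes of the standard multiplication `Q * Kᵀ` of an `m × d` by a `d × m` matrix: the entries
of `Q` and of `K`, the products `Q i l * K j l`, and the entries of `Q * Kᵀ`. -/
inductive ScoreNode (m d : ℕ) where
  | query (i : Fin m) (l : Fin d)
  | key (j : Fin m) (l : Fin d)
  | prod (i j : Fin m) (l : Fin d)
  | score (i j : Fin m)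

inductive ScoreEdge (m d : ℕ) : ScoreNode m d → ScoreNode m d → Prop where
  | query_prod (i j : Fin m) (l : Fin d) : ScoreEdge m d (.query i l) (.prod i j l)
  | key_prod (i j : Fin m) (l : Fin d) : ScoreEdge m d (.key j l) (.prod i j l)
  | prod_score (i j : Fin m) (l : Fin d) : ScoreEdge m d (.prod i j l) (.score i j)

/-- The edges of the computation that continues the computation of the scores `Q * Kᵀ` with a
DAG `T`, where `out i j w` says that the score `(i, j)` is an input of the node `w` of `T`. -/
inductive ExtendedEdge (m d : ℕ) {W : Type*} (T : Dag W) (out : Fin m → Fin m → W → Prop) :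
    ScoreNode m d ⊕ W → ScoreNode m d ⊕ W → Prop where
  | scorePart {x y : ScoreNode m d} (h : ScoreEdge m d x y) :
      ExtendedEdge m d T out (Sum.inl x) (Sum.inl y)
  | connect {i j : Fin m} {w : W} (h : out i j w) :
      ExtendedEdge m d T out (Sum.inl (.score i j)) (Sum.inr w)
  | rest {w w' : W} (h : T.Adj w w') : ExtendedEdge m d T out (Sum.inr w) (Sum.inr w')

theorem extendedEdge_acyclic (m d : ℕ) {W : Type*} (T : Dag W) (out : Fin m → Fin m → W → Prop)
    (v : ScoreNode m d ⊕ W) : ¬ Relation.TransGen (ExtendedEdge m d T out) v v := by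
  have hr : ∀ x y, Relation.TransGen (ExtendedEdge m d T out) x y → ∀ w, x = Sum.inr w →
      ∃ w', y = Sum.inr w' ∧ Relation.TransGen T.Adj w w' := by
    intro x y h
    induction h with
    | single h1 =>
      rintro w rfl
      cases h1 with
      | rest h => exact ⟨_, rfl, .single h⟩
    | tail _ h2 ih =>
      intro w hw
      obtain ⟨w', rfl, h3⟩ := ih w hw
      cases h2 with
      | rest h => exact ⟨_, rfl, h3.tail h⟩
  let f : ScoreNode m d ⊕ W → ℕ := fun x => match x with
    | .inl (.query _ _) => 0
    | .inl (.key _ _) => 0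
    | .inl (.prod _ _ _) => 1
    | .inl (.score _ _) => 2
    | .inr _ => 3
  have hf : ∀ x y, Relation.TransGen (ExtendedEdge m d T out) x y →
      f x < f y ∨ (f x = 3 ∧ f y = 3) := by
    have h1 : ∀ x y, ExtendedEdge m d T out x y → f x < f y ∨ (f x = 3 ∧ f y = 3) := by
      intro x y h
      cases h with
      | scorePart h => cases h <;> simp [f]
      | connect h => simp [f]
      | rest h => simp [f]
    intro x y h
    induction h with
    | single h => exact h1 _ _ h
    | tail _ h ih => have := h1 _ _ h; omega
  intro h
  rcases v with x | w
  · have h3 := hf _ _ h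
    cases x <;> simp [f] at h3
  · obtain ⟨w', hw, h4⟩ := hr _ _ h w rfl
    cases hw
    exact T.acyclic _ h4

/-- The DAG that first computes the scores `Q * Kᵀ` by standard matrix multiplication and then
continues with the DAG `T`. -/
def extendedDag (m d : ℕ) {W : Type*} (T : Dag W) (out : Fin m → Fin m → W → Prop) :
    Dag (ScoreNode m d ⊕ W) where
  Adj := ExtendedEdge m d T out
  acyclic := extendedEdge_acyclic m d T out

/-- The nodes that follow the scores in `softmax (Q * Kᵀ) * V`, for an `m × d` matrix `V`: the
exponentials of the scores, their row sums, the normalised weights, the entries of `V`, the products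
of weights and entries of `V`, and the entries of the output. -/
inductive SoftmaxNode (m d : ℕ) where
  | exp (i j : Fin m)
  | rowSum (i : Fin m)
  | weight (i j : Fin m)
  | value (j : Fin m) (l : Fin d)
  | prod (i j : Fin m) (l : Fin d)
  | output (i : Fin m) (l : Fin d)

inductive SoftmaxEdge (m d : ℕ) : SoftmaxNode m d → SoftmaxNode m d → Prop where
  | exp_rowSum (i j : Fin m) : SoftmaxEdge m d (.exp i j) (.rowSum i)
  | exp_weight (i j : Fin m) : SoftmaxEdge m d (.exp i j) (.weight i j)
  | rowSum_weight (i j : Fin m) : SoftmaxEdge m d (.rowSum i) (.weight i j)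
  | weight_prod (i j : Fin m) (l : Fin d) : SoftmaxEdge m d (.weight i j) (.prod i j l)
  | value_prod (i j : Fin m) (l : Fin d) : SoftmaxEdge m d (.value j l) (.prod i j l)
  | prod_output (i j : Fin m) (l : Fin d) : SoftmaxEdge m d (.prod i j l) (.output i l)

def softmaxDag (m d : ℕ) : Dag (SoftmaxNode m d) where
  Adj := SoftmaxEdge m d
  acyclic := Dag.acyclic_of_rank
    (fun x => match x with
      | .exp _ _ => 0
      | .rowSum _ => 1
      | .weight _ _ => 2
      | .value _ _ => 2
      | .prod _ _ _ => 3
      | .output _ _ => 4)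
    (by intro u v h; cases h <;> simp)

/-- The self-attention DAG, which computes `softmax (Q * Kᵀ) * V` with standard matrix
multiplication; each score has exactly one outgoing edge, to its exponential. -/
def selfAttentionDag (m d : ℕ) : Dag (ScoreNode m d ⊕ SoftmaxNode m d) :=
  extendedDag m d (softmaxDag m d) (fun i j w => w = .exp i j)

end Attention

/-! A partition argument in the style of Hong and Kung, applied to the edges from products to
scores. Cut a strategy into segments of cost exactly `r` and a remainder. Call a node active in a
segment if it is red at its start or end, or is saved or loaded within it; there are at most `3 * r`
such nodes. An inactive node that takes part in the segment had no pebble at its start. So if an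
inactive product is added to its score, it was computed within the segment and its two source inputs
are active (`Play.mem_active_of_isSource`); if the score is inactive too, all its `d` summands are
added in that segment (`Play.complete_of_not_mem_active`).

With `a` active nodes this leaves at most `a + a√a + a²/d` additions (`card_products_le`). All `m²d`
additions must happen, which bounds the cost from below once it is at least `r`; for smaller costs
the `m * d` unavoidable loads of `Q` suffice. What follows the scores matters only through their
outgoing edges, which forbid dropping a partial sum. -/

namespace PRBP

/-! ### Runs of the game and their invariants. -/

variable {V : Type*} {G : Dag V} {r : ℕ}

/-- The moves `l` lead from `s` to `s'`, are legal, and never use more than `r` red pebbles. -/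
inductive Play (G : Dag V) (r : ℕ) : Config V → List (Move V) → Config V → Prop where
  | nil {s : Config V} (h : FitsIn s r) : Play G r s [] s
  | cons {s s' : Config V} {a : Move V} {l : List (Move V)} (h : FitsIn s r) (ha : Legal G s a)
      (hl : Play G r (step s a) l s') : Play G r s (a :: l) s'

theorem Completes.fitsIn {s : Config V} {l : List (Move V)} (h : Completes G r s l) :
    FitsIn s r := by
  cases l with
  | nil => exact h.1
  | cons a l => exact h.1

theorem Completes.split {s : Config V} {l₁ l₂ : List (Move V)}
    (h : Completes G r s (l₁ ++ l₂)) : ∃ s', Play G r s l₁ s' ∧ Completes G r s' l₂ := by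
  induction l₁ generalizing s with
  | nil => exact ⟨s, .nil h.fitsIn, h⟩
  | cons a l ih =>
    obtain ⟨h1, h2, h3⟩ := h
    obtain ⟨s', h4, h5⟩ := ih h3
    exact ⟨s', .cons h1 h2 h4, h5⟩

theorem Completes.exists_play {s : Config V} {l : List (Move V)} (h : Completes G r s l) :
    ∃ s', Play G r s l s' ∧ Terminal G s' := by
  obtain ⟨s', h1, h2⟩ := Completes.split (l₂ := []) (by simpa using h)
  exact ⟨s', h1, h2.2⟩

theorem Play.fitsIn_left {s s' : Config V} {l : List (Move V)} (h : Play G r s l s') :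
    FitsIn s r := by
  cases h <;> assumption

theorem Play.fitsIn_right {s s' : Config V} {l : List (Move V)} (h : Play G r s l s') :
    FitsIn s' r := by
  induction h with
  | nil h => exact h
  | cons _ _ _ ih => exact ih

/-- Properties shared by all configurations that are reachable from the initial one. -/
structure Invariant (G : Dag V) (s : Config V) : Prop where
  marked_of_marked : ∀ u v w, (u, v) ∈ s.marked → G.Adj w u → (w, u) ∈ s.marked
  nonempty : ∀ u v w, (u, v) ∈ s.marked → G.Adj v w → (v, w) ∉ s.marked → s.pebbles v ≠ .empty
  hasBlue_of_isSource : ∀ v, G.IsSource v → (s.pebbles v).HasBlue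

theorem invariant_initial (G : Dag V) : Invariant G (initial G) where
  marked_of_marked u v w h := by simp [initial] at h
  nonempty u v w h := by simp [initial] at h
  hasBlue_of_isSource v hv := by simp [initial, hv, Pebbles.HasBlue]

/-- Only the deletion of a dark pebble empties a node, and it requires all outgoing edges to be
marked. Sources never turn dark, since no compute step enters them. -/
theorem Invariant.step {s : Config V} (hs : Invariant G s) {a : Move V} (ha : Legal G s a) :
    Invariant G (step s a) := by
  classical
  obtain ⟨h1, h2, h3⟩ := hs
  cases a with
  | save x | load x =>
    refine ⟨h1, fun u v w huv hvw hm => ?_, fun v hv => ?_⟩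
    · by_cases hx : v = x
      · simp [PRBP.step, hx]
      · simpa [PRBP.step, hx] using h2 u v w huv hvw hm
    · by_cases hx : v = x
      · simp [PRBP.step, hx, Pebbles.HasBlue]
      · simpa [PRBP.step, hx] using h3 v hv
  | compute x y =>
    obtain ⟨hxy, -, hin, -, -⟩ := ha
    refine ⟨fun u v w huv hwu => ?_, fun u v w huv hvw hm => ?_, fun v hv => ?_⟩
    · simp only [PRBP.step, Set.mem_insert_iff] at huv ⊢
      rcases huv with huv | huv
      · cases huv
        exact .inr (hin w hwu)
      · exact .inr (h1 u v w huv hwu)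
    · by_cases hx : v = y
      · simp [PRBP.step, hx]
      · simp only [PRBP.step, Set.mem_insert_iff, not_or, Prod.mk.injEq, hx, and_false,
          false_or] at huv hm
        simpa [PRBP.step, hx] using h2 u v w huv hvw hm.2
    · have hx : v ≠ y := by
        rintro rfl
        exact hv x hxy
      simpa [PRBP.step, hx] using h3 v hv
  | delete x =>
    refine ⟨h1, fun u v w huv hvw hm => ?_, fun v hv => ?_⟩
    · by_cases hx : v = x
      · subst hx
        rcases ha with ha | ha
        · simp [PRBP.step, ha]
        · exact absurd (ha.2 w hvw) hm
      · simpa [PRBP.step, hx] using h2 u v w huv hvw hm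
    · by_cases hx : v = x
      · subst hx
        rcases ha with ha | ha
        · simp [PRBP.step, ha, Pebbles.HasBlue]
        · have := h3 v hv
          simp [ha.1, Pebbles.HasBlue] at this
      · simpa [PRBP.step, hx] using h3 v hv

theorem Play.invariant {s s' : Config V} {l : List (Move V)} (h : Play G r s l s')
    (hs : Invariant G s) : Invariant G s' := by
  induction h with
  | nil => exact hs
  | cons _ ha _ ih => exact ih (hs.step ha)

/-! ### Transfers and active nodes. -/

/-- Saves and loads are the moves that transfer a value between the two memories. -/
def transferred (l : List (Move V)) : Set V := {v | .save v ∈ l ∨ .load v ∈ l}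

theorem encard_transferred_le (l : List (Move V)) :
    (transferred l).encard ≤ (cost l : ℕ∞) := by
  induction l with
  | nil => simp [transferred]
  | cons a l ih =>
    have hcost : cost (a :: l) = cost l + a.cost := by simp [cost, add_comm]
    rw [hcost]
    have key : ∀ x : V, transferred (a :: l) ⊆ insert x (transferred l) → a.cost = 1 →
        (transferred (a :: l)).encard ≤ ((cost l + a.cost : ℕ) : ℕ∞) := by
      intro x hx ha
      refine (Set.encard_le_encard hx).trans ((Set.encard_insert_le _ _).trans ?_)
      rw [ha]
      push_cast
      gcongr
    cases a with
    | save x | load x =>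
      refine key x (fun v hv => ?_) rfl
      simp only [transferred, List.mem_cons, Set.mem_ofPred_eq, Set.mem_insert_iff] at hv ⊢
      grind
    | compute x y | delete x => simpa [transferred, Move.cost] using ih

/-- A value that lies in slow memory only, and is not loaded, takes no part in the computation. -/
theorem Play.mem_marked_of_blue {s s' : Config V} {l : List (Move V)} (h : Play G r s l s')
    {v : V} (hv : s.pebbles v = .blue) (hl : .load v ∉ l) {x y : V} (hxy : x = v ∨ y = v)
    (hm : (x, y) ∈ s'.marked) : (x, y) ∈ s.marked := by
  classical
  induction h with
  | nil => exact hm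
  | @cons s s' a l _ ha _ ih =>
    simp only [List.mem_cons, not_or] at hl
    -- A node with only a blue pebble can be neither saved nor deleted, and no compute step may read
    -- or update it; only a load changes this.
    cases a with
    | save u =>
      have hu : v ≠ u := by
        rintro rfl
        simp [Legal, hv] at ha
      exact ih (by simpa [step, hu] using hv) hl.2 hm
    | load u =>
      have hu : v ≠ u := by
        rintro rfl
        exact hl.1 rfl
      exact ih (by simpa [step, hu] using hv) hl.2 hm
    | delete u =>
      have hu : v ≠ u := by
        rintro rfl
        simp [Legal, hv] at ha
      exact ih (by simpa [step, hu] using hv) hl.2 hm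
    | compute u w =>
      obtain ⟨-, -, -, h4, h5⟩ := ha
      have hu : u ≠ v := by
        rintro rfl
        simp [Pebbles.HasRed, hv] at h4
      have hw : w ≠ v := by
        rintro rfl
        simp [Pebbles.HasRed, hv] at h5
      have := ih (by simpa [step, hw.symm] using hv) hl.2 hm
      simp only [step, Set.mem_insert_iff, Prod.mk.injEq] at this
      rcases this with ⟨rfl, rfl⟩ | this
      · rcases hxy with h | h
        · exact absurd h hu
        · exact absurd h hw
      · exact this

theorem Play.hasBlue_or_save_mem {s s' : Config V} {l : List (Move V)} (h : Play G r s l s')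
    {v : V} (hv : (s'.pebbles v).HasBlue) : (s.pebbles v).HasBlue ∨ .save v ∈ l := by
  classical
  induction h with
  | nil => exact .inl hv
  | @cons s s' a l _ ha _ ih =>
    rcases ih hv with h | h
    · cases a with
      | save u =>
        by_cases hu : v = u
        · simp [hu]
        · exact .inl (by simpa [step, hu] using h)
      | load u =>
        by_cases hu : v = u
        · exact .inl (hu ▸ ha)
        · exact .inl (by simpa [step, hu] using h)
      | compute u w =>
        by_cases hu : v = w
        · simp [step, hu, Pebbles.HasBlue] at h
        · exact .inl (by simpa [step, hu] using h)
      | delete u =>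
        by_cases hu : v = u
        · subst hu
          by_cases hb : s.pebbles v = .blueLight
          · exact .inl (.inr hb)
          · simp [step, hb, Pebbles.HasBlue] at h
        · exact .inl (by simpa [step, hu] using h)
    · exact .inr (List.mem_cons_of_mem _ h)

/-- The nodes that are in fast memory before or after the moves `l`, or are transferred by `l`. -/
def active (s : Config V) (l : List (Move V)) (s' : Config V) : Set V :=
  {v | (s.pebbles v).HasRed} ∪ {v | (s'.pebbles v).HasRed} ∪ transferred l

theorem Play.encard_active_le {s s' : Config V} {l : List (Move V)} (h : Play G r s l s')
    (hl : cost l ≤ r) : (active s l s').encard ≤ ((3 * r : ℕ) : ℕ∞) := by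
  calc (active s l s').encard
      ≤ {v | (s.pebbles v).HasRed}.encard + {v | (s'.pebbles v).HasRed}.encard
          + (transferred l).encard :=
        (Set.encard_union_le _ _).trans (add_le_add (Set.encard_union_le _ _) le_rfl)
    _ ≤ (r : ℕ∞) + r + r := by
        gcongr
        · exact h.fitsIn_left
        · exact h.fitsIn_right
        · exact (encard_transferred_le l).trans (by exact_mod_cast hl)
    _ = ((3 * r : ℕ) : ℕ∞) := by
        norm_cast
        ring

theorem Pebbles.eq_blue_of_not_hasRed {p : Pebbles} (h : ¬ p.HasRed) (hp : p ≠ .empty) :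
    p = .blue := by
  cases p <;> simp_all [Pebbles.HasRed]

/-- A blue-only node that is never loaded stays idle, so an inactive node that is touched can start
with neither a red nor a blue pebble. -/
theorem Play.eq_empty_of_not_mem_active {s s' : Config V} {l : List (Move V)}
    (h : Play G r s l s') {v : V} (hv : v ∉ active s l s') {x y : V} (hxy : x = v ∨ y = v)
    (hm : (x, y) ∉ s.marked) (hm' : (x, y) ∈ s'.marked) : s.pebbles v = .empty := by
  by_contra hne
  simp only [active, transferred, Set.mem_union, Set.mem_ofPred_eq, not_or] at hv
  exact hm (h.mem_marked_of_blue (Pebbles.eq_blue_of_not_hasRed hv.1.1 hne) hv.2.2 hxy hm')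

/-- If a source takes part in the computation, then it is active. -/
theorem Play.mem_active_of_isSource {s s' : Config V} {l : List (Move V)}
    (h : Play G r s l s') (hs : Invariant G s) {x y : V} (hx : G.IsSource x)
    (hm : (x, y) ∉ s.marked) (hm' : (x, y) ∈ s'.marked) : x ∈ active s l s' := by
  by_contra hv
  have h1 := h.eq_empty_of_not_mem_active hv (.inl rfl) hm hm'
  have h2 := hs.hasBlue_of_isSource x hx
  simp [h1, Pebbles.HasBlue] at h2

/-- If a value that is not active is used, then it has been computed from scratch. -/
theorem Play.not_marked_of_not_mem_active {s s' : Config V} {l : List (Move V)}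
    (h : Play G r s l s') (hs : Invariant G s) {v w : V} (hv : v ∉ active s l s')
    (hvw : G.Adj v w) (hm : (v, w) ∉ s.marked) (hm' : (v, w) ∈ s'.marked) (u : V) :
    (u, v) ∉ s.marked :=
  fun hu => hs.nonempty u v w hu hvw hm (h.eq_empty_of_not_mem_active hv (.inl rfl) hm hm')

/-- If a value that is not active is updated, then it is computed completely. -/
theorem Play.complete_of_not_mem_active {s s' : Config V} {l : List (Move V)}
    (h : Play G r s l s') (hs : Invariant G s) {u v w : V} (hv : v ∉ active s l s')
    (huv : G.Adj u v) (hvw : G.Adj v w) (hm : (u, v) ∉ s.marked) (hm' : (u, v) ∈ s'.marked)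
    {x : V} (hx : G.Adj x v) : (x, v) ∉ s.marked ∧ (x, v) ∈ s'.marked := by
  have he := h.eq_empty_of_not_mem_active hv (.inr rfl) hm hm'
  refine ⟨fun hxv => ?_, ?_⟩
  -- `(v, w)` is unmarked at the start, since otherwise `(u, v)` would be marked; a marked in-edge
  -- would then force a pebble on `v`.
  · exact hs.nonempty x v w hxv hvw (fun hvw' => hm (hs.marked_of_marked v w u hvw' huv)) he
  -- An incomplete value keeps a pebble until the end. Being inactive, it would be blue, but an
  -- initially empty node becomes blue only by a save, which makes it active.
  · by_contra hxv
    have hs' := h.invariant hs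
    have hne := hs'.nonempty u v w hm' hvw (fun hvw' => hxv (hs'.marked_of_marked v w x hvw' hx))
    simp only [active, transferred, Set.mem_union, Set.mem_ofPred_eq, not_or] at hv
    have hb := Pebbles.eq_blue_of_not_hasRed hv.1.2 hne
    rcases h.hasBlue_or_save_mem (.inl hb) with h1 | h1
    · simp [he, Pebbles.HasBlue] at h1
    · exact hv.2.1 h1

/-- A sequence of moves that costs at least `k` has a prefix that costs exactly `k`. -/
theorem exists_append_cost_eq (l : List (Move V)) (k : ℕ) (hk : k ≤ cost l) :
    ∃ l₁ l₂, l = l₁ ++ l₂ ∧ cost l₁ = k ∧ cost l = k + cost l₂ := by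
  induction l generalizing k with
  | nil => exact ⟨[], [], rfl, by simp [cost] at hk ⊢; omega, by simp [cost] at hk ⊢; omega⟩
  | cons a l ih =>
    have hcost : ∀ l' : List (Move V), cost (a :: l') = a.cost + cost l' := by simp [cost]
    -- No move costs more than 1, so the costs of prefixes skip no value.
    have ha : a.cost ≤ 1 := by cases a <;> simp [Move.cost]
    rcases Nat.eq_zero_or_pos k with rfl | hpos
    · exact ⟨[], a :: l, rfl, rfl, by simp⟩
    · rw [hcost] at hk
      obtain ⟨l₁, l₂, rfl, h1, h2⟩ := ih (k - a.cost) (by omega)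
      exact ⟨a :: l₁, l₂, rfl, by rw [hcost]; omega, by rw [hcost]; omega⟩

end PRBP

namespace Attention

open Finset PRBP

/-! ### Counting additions for a given set of active nodes. -/

section Counting

variable {m d : ℕ}

open Classical in
theorem card_mul_le_of_forall_mem {α β γ : Type*} [Fintype α] [Fintype β] (f : α → β → γ)
    (hf : ∀ x y x' y', f x y = f x' y' → x = x' ∧ y = y') (A : Finset γ) :
    #{x | ∀ y, f x y ∈ A} * Fintype.card β ≤ #A := by
  rw [← card_univ, ← card_product]
  refine card_le_card_of_injOn (fun z => f z.1 z.2) ?_ ?_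
  · intro z hz
    simp only [coe_product, coe_filter, coe_univ, Set.mem_prod, Set.mem_ofPred_eq, mem_univ,
      true_and] at hz
    exact hz.1 z.2
  · intro z _ z' _ h
    exact Prod.ext_iff.2 (hf _ _ _ _ h)

open Classical in
theorem sum_card_le {α β γ : Type*} [Fintype α] [Fintype β] (f : α → β → γ)
    (hf : ∀ x y x' y', f x y = f x' y' → x = x' ∧ y = y') (A : Finset γ) :
    ∑ y, #{x | f x y ∈ A} ≤ #A := by
  rw [← card_sigma]
  refine card_le_card_of_injOn (fun z => f z.2 z.1) ?_ ?_
  · intro z hz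
    simpa using hz
  · rintro ⟨y, x⟩ _ ⟨y', x'⟩ _ h
    obtain ⟨rfl, rfl⟩ := hf _ _ _ _ h
    rfl

/-- Geometric mean of the two bounds, then AM-GM. A bound linear in `p + q` can be summed over the
`d` coordinates. -/
theorem le_sqrt_mul_of_le {n p q a : ℕ} (h1 : n ≤ a) (h2 : n ≤ p * q) :
    (n : ℝ) ≤ √a * ((p + q) / 2) := by
  rw [← Real.sqrt_sq (Nat.cast_nonneg n), ← Real.sqrt_sq (by positivity : (0 : ℝ) ≤ (p + q) / 2),
    ← Real.sqrt_mul (Nat.cast_nonneg a)]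
  apply Real.sqrt_le_sqrt
  have h3 : (n : ℝ) ≤ a := by exact_mod_cast h1
  have h4 : (n : ℝ) ≤ p * q := by exact_mod_cast h2
  calc (n : ℝ) ^ 2 = n * n := sq _
    _ ≤ a * (p * q) := by gcongr
    _ ≤ a * ((p + q) / 2) ^ 2 := by
        gcongr
        nlinarith [sq_nonneg ((p : ℝ) - q)]

/-- The number of products that can be added to their scores with a set `A` of active nodes. -/
theorem card_products_le (hd : 0 < d) (A : Finset (ScoreNode m d))
    (T : Finset (Fin m × Fin m × Fin d))
    (hT : ∀ i j l, (i, j, l) ∈ T → .prod i j l ∈ A ∨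
      (.query i l ∈ A ∧ .key j l ∈ A ∧ (.score i j ∈ A ∨ ∀ l', (i, j, l') ∈ T))) :
    (#T : ℝ) ≤ #A + #A * √(#A) + (#A : ℝ) ^ 2 / d := by
  classical
  -- Including the pairs with an active product ensures that outside `S` a sum is built from
  -- inactive products only.
  let S : Finset (Fin m × Fin m) := {z | .score z.1 z.2 ∈ A ∨ ∃ l, .prod z.1 z.2 l ∈ A}
  let R : Finset (Fin m) := {i | ∀ l, .query i l ∈ A}
  let C : Finset (Fin m) := {j | ∀ l, .key j l ∈ A}
  let T₁ : Finset (Fin m × Fin m × Fin d) := {z | .prod z.1 z.2.1 z.2.2 ∈ A}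
  let F : Fin d → Finset (Fin m × Fin m) := fun l => {z ∈ S | .query z.1 l ∈ A ∧ .key z.2 l ∈ A}
  have hS : #S ≤ #A := by
    let g : ScoreNode m d → Option (Fin m × Fin m) := fun x => match x with
      | .score i j => some (i, j)
      | .prod i j _ => some (i, j)
      | _ => none
    calc #S = #(S.image some) := (card_image_of_injective _ (Option.some_injective _)).symm
      _ ≤ #(A.image g) := by
          refine card_le_card fun z hz => ?_
          obtain ⟨⟨i, j⟩, h, rfl⟩ := mem_image.1 hz
          rcases (mem_filter.1 h).2 with h | ⟨l, h⟩
          · exact mem_image.2 ⟨_, h, rfl⟩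
          · exact mem_image.2 ⟨_, h, rfl⟩
      _ ≤ #A := card_image_le
  have hT₁ : #T₁ ≤ #A := by
    refine card_le_card_of_injOn (fun z => .prod z.1 z.2.1 z.2.2) ?_ ?_
    · intro z hz
      simpa [T₁] using hz
    · rintro ⟨i, j, l⟩ _ ⟨i', j', l'⟩ _ h
      simpa using h
  have hF : (∑ l, #(F l) : ℝ) ≤ #A * √(#A) := by
    -- For fixed `l`, `F l` has at most `#A` pairs and lies in the product of the active parts of
    -- column `l` of `Q` and of `K`.
    calc (∑ l, #(F l) : ℝ)
        ≤ ∑ l, √(#A) * (((#{i | ScoreNode.query i l ∈ A} : ℕ)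
            + (#{j | ScoreNode.key j l ∈ A} : ℕ) : ℝ) / 2) := by
          refine sum_le_sum fun l _ => le_sqrt_mul_of_le ((card_filter_le _ _).trans hS) ?_
          rw [← card_product]
          refine card_le_card fun z hz => ?_
          have := (mem_filter.1 hz).2
          simpa using this
      _ = √(#A) * (((∑ l, #{i | ScoreNode.query i l ∈ A} : ℕ)
            + (∑ l, #{j | ScoreNode.key j l ∈ A} : ℕ) : ℝ) / 2) := by
          rw [← mul_sum, ← sum_div, sum_add_distrib]
          push_cast
          rfl
      _ ≤ √(#A) * ((#A + #A : ℝ) / 2) := by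
          gcongr
          · exact sum_card_le _ (by simp) A
          · exact sum_card_le _ (by simp) A
      _ = #A * √(#A) := by ring
  have hRC : ((#R * #C * d : ℕ) : ℝ) ≤ (#A : ℝ) ^ 2 / d := by
    have h1 : #R * d ≤ #A := by
      have h := card_mul_le_of_forall_mem (ScoreNode.query (m := m) (d := d)) (by simp) A
      rw [Fintype.card_fin] at h
      convert h
    have h2 : #C * d ≤ #A := by
      have h := card_mul_le_of_forall_mem (ScoreNode.key (m := m) (d := d)) (by simp) A
      rw [Fintype.card_fin] at h
      convert h
    rw [le_div_iff₀ (by exact_mod_cast hd)]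
    have h3 := Nat.mul_le_mul h1 h2
    have h4 : #R * #C * d * d ≤ #A ^ 2 := by nlinarith
    exact_mod_cast h4
  have hsub : T ⊆ T₁ ∪ ((univ.sigma F).image fun z => (z.2.1, z.2.2, z.1)) ∪
      R ×ˢ C ×ˢ (univ : Finset (Fin d)) := by
    rintro ⟨i, j, l⟩ h
    by_cases h1 : ScoreNode.prod i j l ∈ A
    · exact mem_union_left _ (mem_union_left _ (by simpa [T₁] using h1))
    obtain ⟨hq, hk, hs⟩ := (hT i j l h).resolve_left h1
    by_cases h2 : (i, j) ∈ S
    · refine mem_union_left _ (mem_union_right _ (mem_image.2 ⟨⟨l, (i, j)⟩, ?_, rfl⟩))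
      simp [F, h2, hq, hk]
    -- The whole sum is added here from inactive products, so row `i` of `Q` and row `j` of `K` are
    -- entirely active.
    · have h3 : ScoreNode.score i j ∉ A ∧ ∀ l, ScoreNode.prod i j l ∉ A := by
        simpa [S] using h2
      have h4 := fun l' => (hT i j l' (hs.resolve_left h3.1 l')).resolve_left (h3.2 l')
      refine mem_union_right _ ?_
      simpa [R, C] using ⟨fun l' => (h4 l').1, fun l' => (h4 l').2.1⟩
  have hcard : #T ≤ #T₁ + ∑ l, #(F l) + #R * #C * d := by
    refine (card_le_card hsub).trans ((card_union_le _ _).trans ?_)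
    gcongr
    · refine (card_union_le _ _).trans ?_
      gcongr
      exact card_image_le.trans (card_sigma _ _).le
    · simp [mul_assoc]
  calc (#T : ℝ) ≤ ((#T₁ + ∑ l, #(F l) + #R * #C * d : ℕ) : ℝ) := by exact_mod_cast hcard
    _ = #T₁ + ∑ l, (#(F l) : ℝ) + ((#R * #C * d : ℕ) : ℝ) := by push_cast; rfl
    _ ≤ _ := by gcongr

end Counting

/-! ### From segments to the bound on the cost. -/

section LowerBound

variable {m d r : ℕ} {W : Type*} {T : Dag W} {out : Fin m → Fin m → W → Prop}

/-- The edge along which a product is added to its score. -/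
def addEdge (W : Type*) (z : Fin m × Fin m × Fin d) :
    (ScoreNode m d ⊕ W) × (ScoreNode m d ⊕ W) :=
  (.inl (.prod z.1 z.2.1 z.2.2), .inl (.score z.1 z.2.1))

theorem isSource_query (i : Fin m) (l : Fin d) :
    (extendedDag m d T out).IsSource (.inl (.query i l)) := by
  rintro u (⟨h⟩)
  cases ‹ScoreEdge m d _ _›

theorem isSource_key (j : Fin m) (l : Fin d) :
    (extendedDag m d T out).IsSource (.inl (.key j l)) := by
  rintro u (⟨h⟩)
  cases ‹ScoreEdge m d _ _›

theorem adj_query_prod (i j : Fin m) (l : Fin d) :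
    (extendedDag m d T out).Adj (.inl (.query i l)) (.inl (.prod i j l)) :=
  .scorePart (.query_prod i j l)

theorem adj_key_prod (i j : Fin m) (l : Fin d) :
    (extendedDag m d T out).Adj (.inl (.key j l)) (.inl (.prod i j l)) :=
  .scorePart (.key_prod i j l)

theorem adj_prod_score (i j : Fin m) (l : Fin d) :
    (extendedDag m d T out).Adj (.inl (.prod i j l)) (.inl (.score i j)) :=
  .scorePart (.prod_score i j l)

/-- A bound on the number of products that are added while at most `r` transfers are made. -/
noncomputable def segmentBound (d r : ℕ) : ℝ :=
  (3 * r : ℕ) + (3 * r : ℕ) * √(3 * r : ℕ) + ((3 * r : ℕ) : ℝ) ^ 2 / d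

theorem segmentBound_nonneg (d r : ℕ) : 0 ≤ segmentBound d r := by
  unfold segmentBound
  positivity

open Classical in
theorem card_added_le (hd : 0 < d) (hout : ∀ i j, ∃ w, out i j w)
    {s s' : Config (ScoreNode m d ⊕ W)} {l : List (Move (ScoreNode m d ⊕ W))}
    (h : Play (extendedDag m d T out) r s l s') (hs : Invariant (extendedDag m d T out) s)
    (hl : cost l ≤ r) :
    (#{z | addEdge W z ∉ s.marked ∧ addEdge W z ∈ s'.marked} : ℝ) ≤ segmentBound d r := by
  have henc := h.encard_active_le hl
  have hfin : (active s l s').Finite := Set.finite_of_encard_le_coe henc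
  let A : Finset (ScoreNode m d) := hfin.toFinset.preimage Sum.inl Sum.inl_injective.injOn
  have hA : ∀ x, x ∈ A ↔ Sum.inl x ∈ active s l s' := by simp [A]
  have hcard : #A ≤ 3 * r := by
    calc #A ≤ #hfin.toFinset :=
          card_le_card_of_injOn Sum.inl (fun x hx => by simpa [A] using hx)
            Sum.inl_injective.injOn
      _ ≤ 3 * r := by
          rw [hfin.encard_eq_coe_toFinset_card] at henc
          exact_mod_cast henc
  refine (card_products_le hd A _ fun i j k hz => ?_).trans ?_
  · simp only [mem_filter, mem_univ, true_and, hA] at hz ⊢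
    by_cases hp : Sum.inl (.prod i j k) ∈ active s l s'
    · exact .inl hp
    obtain ⟨w, hw⟩ := hout i j
    have hadj := adj_prod_score (T := T) (out := out) i j k
    have hnot := h.not_marked_of_not_mem_active hs hp hadj hz.1 hz.2
    have hin := fun u => (h.invariant hs).marked_of_marked _ _ u hz.2
    refine .inr ⟨?_, ?_, ?_⟩
    · exact h.mem_active_of_isSource hs (isSource_query i k) (hnot _)
        (hin _ (adj_query_prod i j k))
    · exact h.mem_active_of_isSource hs (isSource_key j k) (hnot _)
        (hin _ (adj_key_prod i j k))
    · by_cases hsc : Sum.inl (.score i j) ∈ active s l s'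
      · exact .inl hsc
      · exact .inr fun k' => h.complete_of_not_mem_active hs hsc hadj (w := .inr w)
          (.connect hw) hz.1 hz.2 (adj_prod_score i j k')
  · unfold segmentBound
    gcongr

-- Segments of cost exactly `r` are peeled off; the extra 1 pays for the remainder. The start
-- configuration is arbitrary so that the induction can resume in the middle of a strategy.
open Classical in
theorem card_unmarked_le (hd : 0 < d) (hr : 0 < r) (hout : ∀ i j, ∃ w, out i j w) (n : ℕ) :
    ∀ (s : Config (ScoreNode m d ⊕ W)) (l : List (Move (ScoreNode m d ⊕ W))), cost l ≤ n →
      Invariant (extendedDag m d T out) s → Completes (extendedDag m d T out) r s l →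
      (#{z : Fin m × Fin m × Fin d | addEdge W z ∉ s.marked} : ℝ)
        ≤ ((cost l : ℝ) / r + 1) * segmentBound d r := by
  induction n using Nat.strong_induction_on with
  | _ n ih =>
    intro s l hn hs hl
    have hB := segmentBound_nonneg d r
    rcases le_or_gt (cost l) r with hle | hlt
    · obtain ⟨s', h1, h2⟩ := hl.exists_play
      have h3 := card_added_le hd hout h1 hs hle
      have h4 : ∀ z : Fin m × Fin m × Fin d, addEdge W z ∈ s'.marked :=
        fun z => h2.2 _ _ (adj_prod_score _ _ _)
      simp only [h4, and_true] at h3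
      refine h3.trans (le_mul_of_one_le_left hB ?_)
      have : (0 : ℝ) ≤ cost l / r := by positivity
      linarith
    · obtain ⟨l₁, l₂, rfl, h1, h2⟩ := exists_append_cost_eq l r hlt.le
      obtain ⟨s', h3, h4⟩ := hl.split
      have h5 := card_added_le hd hout h3 hs h1.le
      have h6 := ih (cost l₂) (by omega) s' l₂ le_rfl (h3.invariant hs) h4
      have h7 : #{z : Fin m × Fin m × Fin d | addEdge W z ∉ s.marked} ≤
          #{z | addEdge W z ∉ s.marked ∧ addEdge W z ∈ s'.marked} +
            #{z : Fin m × Fin m × Fin d | addEdge W z ∉ s'.marked} := by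
        refine (card_le_card fun z hz => ?_).trans (card_union_le _ _)
        by_cases hz' : addEdge W z ∈ s'.marked <;> simp_all
      have h8 : ((cost (l₁ ++ l₂) : ℕ) : ℝ) = r + cost l₂ := by exact_mod_cast h2
      have hr' : (r : ℝ) ≠ 0 := by positivity
      calc _ ≤ ((_ + _ : ℕ) : ℝ) := Nat.cast_le.2 h7
        _ ≤ segmentBound d r + ((cost l₂ : ℝ) / r + 1) * segmentBound d r := by
            push_cast
            exact add_le_add h5 h6
        _ = _ := by
            rw [h8, add_div, div_self hr']
            ring

/-- Every entry of `Q` starts in slow memory and must be loaded. This covers costs below `r`, where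
counting segments is too weak. -/
theorem mul_le_cost {l : List (Move (ScoreNode m d ⊕ W))}
    (hl : IsStrategy (extendedDag m d T out) r l) : m * d ≤ cost l := by
  classical
  obtain ⟨s', h1, h2⟩ := Completes.exists_play hl
  have hload : ∀ z : Fin m × Fin d,
      (Sum.inl (.query z.1 z.2) : ScoreNode m d ⊕ W) ∈ transferred l := by
    intro z
    by_contra hz
    simp only [transferred, Set.mem_ofPred_eq, not_or] at hz
    have h3 := h1.mem_marked_of_blue (v := .inl (.query z.1 z.2))
      (by simp [initial, isSource_query]) hz.2 (.inl rfl)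
      -- Any edge leaving the query entry would do; the diagonal product needs no choice of a second
      -- index.
      (h2.2 _ _ (adj_query_prod z.1 z.1 z.2))
    simp [initial] at h3
  have hinj : Function.Injective
      fun z : Fin m × Fin d => (Sum.inl (.query z.1 z.2) : ScoreNode m d ⊕ W) := by
    rintro ⟨i, k⟩ ⟨i', k'⟩ h
    simpa using h
  have h4 := (Set.encard_le_encard (Set.range_subset_iff.2 hload)).trans (encard_transferred_le l)
  rw [← Set.image_univ, hinj.encard_image, Set.encard_univ] at h4
  simp only [ENat.card_eq_coe_fintype_card, Fintype.card_prod, Fintype.card_fin] at h4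
  exact_mod_cast h4

/-- As `1 ≤ √r`, the linear term is absorbed into `r√r`; with `√3 ≤ 2` the factor 9 already
suffices. -/
theorem segmentBound_le (hr : 0 < r) :
    segmentBound d r ≤ 12 * (r * (√r + r / d)) := by
  have hr1 : (1 : ℝ) ≤ r := by exact_mod_cast hr
  have h1 : (1 : ℝ) ≤ √r := Real.one_le_sqrt.2 hr1
  have h2 : √(3 * r : ℝ) ≤ 2 * √r := by
    rw [Real.sqrt_le_left (by positivity), mul_pow, Real.sq_sqrt (by positivity)]
    linarith
  have h3 : (0 : ℝ) ≤ r ^ 2 / d := by positivity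
  unfold segmentBound
  push_cast
  calc (3 * r : ℝ) + 3 * r * √(3 * r) + (3 * r) ^ 2 / d
      ≤ 3 * r * √r + 3 * r * (2 * √r) + (3 * r) ^ 2 / d := by
        have h4 : (3 * r : ℝ) ≤ 3 * r * √r := le_mul_of_one_le_right (by positivity) h1
        gcongr
    _ = 9 * (r * √r) + 9 * (r ^ 2 / d) := by ring
    _ ≤ 12 * (r * √r) + 12 * (r ^ 2 / d) := by
        gcongr <;> norm_num
    _ = _ := by ring

theorem le_cost (hd : 0 < d) (hr : 0 < r) (hout : ∀ i j, ∃ w, out i j w)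
    {l : List (Move (ScoreNode m d ⊕ W))} (hl : IsStrategy (extendedDag m d T out) r l) :
    1 / 48 * min ((m : ℝ) ^ 2 * d / √(r : ℝ)) ((m : ℝ) ^ 2 * (d : ℝ) ^ 2 / r) ≤ cost l := by
  classical
  have hr0 : (0 : ℝ) < r := by exact_mod_cast hr
  have hd0 : (0 : ℝ) < d := by exact_mod_cast hd
  have hs0 : 0 < √(r : ℝ) := Real.sqrt_pos.2 hr0
  have hmd : (m * d : ℝ) ≤ cost l := by exact_mod_cast mul_le_cost hl
  set c : ℝ := (cost l : ℝ) with hc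
  have hc0 : 0 ≤ c := by positivity
  rcases lt_or_ge c r with hlt | hge
  · have h1 : (m : ℝ) ^ 2 * (d : ℝ) ^ 2 / r ≤ c := by
      rw [div_le_iff₀ hr0]
      calc (m : ℝ) ^ 2 * (d : ℝ) ^ 2 = (m * d) * (m * d) := by ring
        _ ≤ c * r := by
            gcongr
            exact hmd.trans hlt.le
    have h2 := min_le_right ((m : ℝ) ^ 2 * d / √(r : ℝ)) ((m : ℝ) ^ 2 * (d : ℝ) ^ 2 / r)
    linarith
  -- Here `c / r + 1 ≤ 2c / r`, whence 24 = 2 · 12 below; replacing `√r + r / d` by twice its larger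
  -- term gives 48.
  · have h1 := card_unmarked_le (T := T) hd hr hout _ _ l le_rfl (invariant_initial _) hl
    have h2 : (#{z : Fin m × Fin m × Fin d |
        addEdge W z ∉ (initial (extendedDag m d T out)).marked} : ℝ) = m ^ 2 * d := by
      simp [initial]
      ring
    rw [h2, ← hc] at h1
    have h3 : (m : ℝ) ^ 2 * d ≤ 24 * c * (√r + r / d) := by
      calc (m : ℝ) ^ 2 * d ≤ (c / r + 1) * segmentBound d r := h1
        _ ≤ (c / r + c / r) * (12 * (r * (√r + r / d))) := by
            gcongr
            · exact segmentBound_nonneg d r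
            · rwa [le_div_iff₀ hr0, one_mul]
            · exact segmentBound_le hr
        _ = _ := by
            field_simp
            ring
    rcases le_total ((r : ℝ) / d) √r with h4 | h4
    · refine (mul_le_mul_of_nonneg_left (min_le_left _ _) (by norm_num)).trans ?_
      have h5 : (m : ℝ) ^ 2 * d ≤ 48 * c * √r := by
        calc (m : ℝ) ^ 2 * d ≤ 24 * c * (√r + √r) := h3.trans (by gcongr)
          _ = _ := by ring
      have h6 := (div_le_iff₀ hs0).2 h5
      linarith
    · refine (mul_le_mul_of_nonneg_left (min_le_right _ _) (by norm_num)).trans ?_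
      have h5 : (m : ℝ) ^ 2 * d ^ 2 ≤ 48 * c * r := by
        calc (m : ℝ) ^ 2 * d ^ 2 = (m ^ 2 * d) * d := by ring
          _ ≤ (24 * c * (r / d + r / d)) * d :=
              mul_le_mul_of_nonneg_right (h3.trans (by gcongr)) hd0.le
          _ = _ := by
              field_simp
              ring
      have h6 := (div_le_iff₀ hr0).2 h5
      linarith

theorem le_opt (hd : 0 < d) (hr : 0 < r) (hout : ∀ i j, ∃ w, out i j w) :
    ENNReal.ofReal
        (1 / 48 * min ((m : ℝ) ^ 2 * d / √(r : ℝ)) ((m : ℝ) ^ 2 * (d : ℝ) ^ 2 / r))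
      ≤ (opt (extendedDag m d T out) r : ENNReal) := by
  set x : ℝ := 1 / 48 * min ((m : ℝ) ^ 2 * d / √(r : ℝ)) ((m : ℝ) ^ 2 * (d : ℝ) ^ 2 / r) with hx
  -- Costs are integers, so the real bound may be rounded up before passing to the infimum in `ℕ∞`.
  have h1 : (⌈x⌉₊ : ℕ∞) ≤ opt (extendedDag m d T out) r :=
    le_iInf₂ fun l hl => Nat.cast_le.2 (Nat.ceil_le.2 (le_cost hd hr hout hl))
  calc ENNReal.ofReal x ≤ ENNReal.ofReal (⌈x⌉₊ : ℝ) := ENNReal.ofReal_le_ofReal (Nat.le_ceil x)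
    _ = ((⌈x⌉₊ : ℕ∞) : ENNReal) := by simp
    _ ≤ _ := by exact_mod_cast h1

end LowerBound

end Attention

theorem mainTheorem6 :
    ∃ c : ℝ, 0 < c ∧ ∀ m d r : ℕ, 0 < m → 0 < d → 0 < r →
      ENNReal.ofReal (c * min ((m : ℝ) ^ 2 * d / √(r : ℝ)) ((m : ℝ) ^ 2 * (d : ℝ) ^ 2 / r))
          ≤ (PRBP.opt (Attention.selfAttentionDag m d) r : ENNReal) ∧
      ∀ (W : Type) [Finite W] (T : Dag W) (out : Fin m → Fin m → W → Prop),
        (∀ i j, ∃ w, out i j w) →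
        ENNReal.ofReal (c * min ((m : ℝ) ^ 2 * d / √(r : ℝ)) ((m : ℝ) ^ 2 * (d : ℝ) ^ 2 / r))
          ≤ (PRBP.opt (Attention.extendedDag m d T out) r : ENNReal) := by
  refine ⟨1 / 48, by norm_num, fun m d r _ hd hr => ⟨?_, fun W _ T out hout => ?_⟩⟩
  · exact Attention.le_opt hd hr fun i j => ⟨_, rfl⟩
  · exact Attention.le_opt hd hr hout
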